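/- Let $n\ge 1$ be an integer and let $K$ be a field with $\operatorname{char}(K)=0$ or $\operatorname{char}(K)>n$. Let $G$ be a group acting linearly on a finite-dimensional $K$-vector space $V$, and let $S(V)$ be the symmetric algebra of $V$, with its standard grading and the induced action of $G$ by $K$-algebra automorphisms; $S(V)^G$ denotes the graded subalgebra of $G$-invariants. The wreath product $G\wr S_n=G^n\rtimes S_n$ acts on $V^n=V\oplus\cdots\oplus V$ by $$(g_1,\dots,g_n,\sigma)\cdot(v_1,\dots,v_n)=(g_1\cdot v_{\sigma^{-1}(1)},\dots,g_n\cdot v_{\sigma^{-1}(n)}),$$ and hence on $S(V^n)$. For $b\in S(V)$ put $$[b]:=b\otimes1\otimes\cdots\otimes1+1\otimes b\otimes1\otimes\cdots\otimes1+\cdots+1\otimes\cdots\otimes1\otimes b\in S(V)^{\otimes n}=S(V^n),$$ that is, $[b]=\sum_{i=1}^n\iota_i(b)$, where $\iota_i:S(V)\to S(V^n)$ is the algebra homomorphism induced by the inclusion of $V$ as the $i$-th summand of $V^n$. A minimal homogeneous generating system of a graded subalgebra $R\subseteq S(V^n)$ is a set of homogeneous elements that generates $R$ as a $K$-algebra and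 no proper subset of which generates $R$. Assume $S(V)^G\ne K$, let $q$ be the least positive degree of a non-zero homogeneous element of $S(V)^G$, and let $\mathcal B$ be the union of $K$-vector space bases of the homogeneous components of $S(V)^G$ of positive degree strictly less than $(n+1)q$, one basis for each component. Then: (i) $\{[b]\mid b\in\mathcal B\}$ is contained in a minimal homogeneous $K$-algebra generating system of $S(V^n)^{G\wr S_n}$. (ii) If in addition $S(V)^G$ is generated as a $K$-algebra by its homogeneous component of degree $q$, then $\{[b]\mid b\in\mathcal B\}$ is itself a minimal homogeneous $K$-algebra generating system of $S(V^n)^{G\wr S_n}$. -/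

import Mathlib

noncomputable section

/-- The `K`-algebra homomorphism `S(V) → S(W)` of symmetric algebras induced by a linear map
`V → W`. -/
def symMap {K V W : Type*} [Field K] [AddCommGroup V] [Module K V] [AddCommGroup W] [Module K W]
    (f : V →ₗ[K] W) : SymmetricAlgebra K V →ₐ[K] SymmetricAlgebra K W :=
  SymmetricAlgebra.lift (SymmetricAlgebra.ι K W ∘ₗ f)

/-- The degree `d` homogeneous component of the symmetric algebra `S(V)`: the span of all products
of `d` elements of `V`. -/
def symDegree (K V : Type*) [Field K] [AddCommGroup V] [Module K V] (d : ℕ) :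
    Submodule K (SymmetricAlgebra K V) :=
  LinearMap.range (SymmetricAlgebra.ι K V) ^ d

/-- The algebra of polynomial invariants `S(V)^G` of a representation `ρ` of `G` on `V`. -/
def polyInvariants {K G V : Type*} [Field K] [Group G] [AddCommGroup V] [Module K V]
    (ρ : Representation K G V) : Subalgebra K (SymmetricAlgebra K V) where
  carrier := {f | ∀ g : G, symMap (ρ g) f = f}
  mul_mem' := fun ha hb g => by rw [map_mul, ha g, hb g]
  add_mem' := fun ha hb g => by rw [map_add, ha g, hb g]
  algebraMap_mem' := fun r g => AlgHom.commutes _ r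

/-- The degree `d` homogeneous component of `S(V)^G`. -/
def invariantsDegree {K G V : Type*} [Field K] [Group G] [AddCommGroup V] [Module K V]
    (ρ : Representation K G V) (d : ℕ) : Submodule K (SymmetricAlgebra K V) :=
  Subalgebra.toSubmodule (polyInvariants ρ) ⊓ symDegree K V d

/-- The wreath product `G ≀ S_n = G^n ⋊ S_n`, where `σ ∈ S_n` acts on `G^n` by
`(g_1, …, g_n) ↦ (g_{σ⁻¹(1)}, …, g_{σ⁻¹(n)})`. -/
abbrev WreathProduct (G : Type*) [Group G] (n : ℕ) : Type _ :=
  (Fin n → G) ⋊[(mulAutArrow : Equiv.Perm (Fin n) →* MulAut (Fin n → G))] Equiv.Perm (Fin n)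

/-- The representation of `G ≀ S_n` on `V^n` given by
`(g_1, …, g_n, σ) · (v_1, …, v_n) = (g_1 · v_{σ⁻¹(1)}, …, g_n · v_{σ⁻¹(n)})`. -/
def wreathRep {K G V : Type*} [Field K] [Group G] [AddCommGroup V] [Module K V]
    (ρ : Representation K G V) (n : ℕ) : Representation K (WreathProduct G n) (Fin n → V) where
  toFun x := LinearMap.pi fun i => ρ (x.left i) ∘ₗ LinearMap.proj (x.right⁻¹ i)
  map_one' := by
    ext
    simp
  map_mul' x y := by
    refine LinearMap.ext fun v => funext fun i => ?_
    simp
    rfl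

/-- The element `[b] = b ⊗ 1 ⊗ ⋯ ⊗ 1 + ⋯ + 1 ⊗ ⋯ ⊗ 1 ⊗ b` of `S(V^n) = T^n(S(V))`.
Under this identification `1 ⊗ ⋯ ⊗ b ⊗ ⋯ ⊗ 1` (with `b` in position `i`) is the image of `b` under
the homomorphism `S(V) → S(V^n)` induced by the `i`-th coordinate inclusion `V → V^n`. -/
def bracket {K V : Type*} [Field K] [AddCommGroup V] [Module K V] (n : ℕ)
    (b : SymmetricAlgebra K V) : SymmetricAlgebra K (Fin n → V) :=
  ∑ i : Fin n, symMap (LinearMap.single K (fun _ : Fin n => V) i) b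

/-- `S` is a minimal homogeneous `K`-algebra generating system of the subalgebra `R` of the
symmetric algebra `S(W)`: it consists of homogeneous elements, generates `R`, and no proper subset
of it generates `R`. -/
structure IsMinimalHomogeneousGenerating {K W : Type*} [Field K] [AddCommGroup W] [Module K W]
    (R : Subalgebra K (SymmetricAlgebra K W)) (S : Set (SymmetricAlgebra K W)) : Prop where
  homogeneous : ∀ s ∈ S, ∃ d : ℕ, s ∈ symDegree K W d
  adjoin_eq : Algebra.adjoin K S = R
  minimal : ∀ T : Set (SymmetricAlgebra K W), T ⊂ S → Algebra.adjoin K T ≠ R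

end

/-!
Write `A = S(V)^G` and `R = S(V^n)^{G ≀ S_n}`, and let `R₊` be the elements of `R` without constant
term.

A homogeneous subset of `R₊` generates `R` if and only if it spans `R₊` modulo the decomposable
elements `R₊²`, and it is a minimal generating system as soon as it is moreover linearly independent
modulo `R₊²` (`adjoin_eq_of_positivePart_le`, `isMinimalHomogeneousGenerating_of_linearIndepOn`).
So (i) asserts that the elements `[b]`, `b ∈ B`, are linearly independent modulo `R₊²`, and (ii)
asserts in addition that they generate `R`.

*Generation.* `S(V^n)` is the tensor power `S(V)^{⊗ n}`, and its invariants under `G^n` are spanned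
by the products `ι_1(a_1) ⋯ ι_n(a_n)` with `a_i ∈ A` (`mem_span_tprod_of_fixed`). As `n!` is
invertible, averaging over `S_n` shows that `R` is spanned by the symmetrized products of elements of
`A`, and multiplying such a product by `[b]` gives a recursion expressing symmetrized products
through elements `[a]`, `a ∈ A` (`bracket_mul_placementSum`, `placementSum_mem`). There is no
symmetrized product of `n + 1` factors; for them the recursion says that `n! [a_0 ⋯ a_n]` is a
polynomial in the elements `[∏_{j ∈ S} a_j]` for proper subsets `S` (`bracket_prod_mem`). If `A` is
generated in degree `q`, then every invariant of degree at least `(n + 1) q` is a combination of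
products of `n + 1` invariants of positive degree, and (ii) follows by induction on the degree.

*Independence.* For `0 ≤ k ≤ n` the sum of the first `k` coordinates `V^n → V` induces an algebra
homomorphism `μ_k : S(V^n) → S(V)` with `μ_k [a] = k a` for `a ∈ A₊`. Hence, for `f ∈ R`, the value
`μ_k f` is a polynomial in `k` whose coefficient of `k^j` is a combination of products of `j` elements
of `A₊`, so has degree at least `j q` (`exists_interpolating_polynomial`). If `f` is decomposable,
the coefficients of `k^0` and `k^1` vanish. As `0, 1, …, n` are distinct in `K`, there are weights
`c_k` for which `∑ c_k p(k)` is the linear coefficient of `p` for every `p` of degree at most `n`.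
Then `∑ c_k μ_k` sends `[a]` to `a` and decomposable elements to elements of degree at least
`(n + 1) q` (`weightedSum_bracket`, `weightedSum_mem_orderGE`), so after truncation it maps the
elements `[b]` to the linearly independent elements `b` and kills `R₊²`.
-/

noncomputable section

open Finset

variable {K V W U : Type*} [Field K] [AddCommGroup V] [Module K V] [AddCommGroup W] [Module K W]
  [AddCommGroup U] [Module K U]

/-! ### Induced homomorphisms and homogeneous components in symmetric algebras -/

@[simp] lemma symMap_ι (f : V →ₗ[K] W) (v : V) :
    symMap f (SymmetricAlgebra.ι K V v) = SymmetricAlgebra.ι K W (f v) := by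
  simp [symMap]

lemma symMap_comp (g : W →ₗ[K] U) (f : V →ₗ[K] W) :
    symMap (g ∘ₗ f) = (symMap g).comp (symMap f) := by
  apply SymmetricAlgebra.algHom_ext
  ext v
  simp

lemma symMap_symMap (g : W →ₗ[K] U) (f : V →ₗ[K] W) (x : SymmetricAlgebra K V) :
    symMap g (symMap f x) = symMap (g ∘ₗ f) x := by
  rw [symMap_comp]; rfl

lemma symMap_id : symMap (LinearMap.id : V →ₗ[K] V) = AlgHom.id K _ := by
  apply SymmetricAlgebra.algHom_ext
  ext v
  simp

lemma symMap_zero (x : SymmetricAlgebra K V) :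
    symMap (0 : V →ₗ[K] W) x = algebraMap K _ (SymmetricAlgebra.algebraMapInv x) := by
  have : symMap (0 : V →ₗ[K] W) = (Algebra.ofId K _).comp SymmetricAlgebra.algebraMapInv := by
    apply SymmetricAlgebra.algHom_ext
    ext v
    simp [SymmetricAlgebra.algebraMapInv_ι]
  rw [this]; rfl

lemma algebraMapInv_algebraMap (c : K) :
    SymmetricAlgebra.algebraMapInv (algebraMap K (SymmetricAlgebra K V) c) = c := by
  simp

/-- The grading of `S(V)` encoded as a homomorphism to `S(V)[t]`: it sends `v ∈ V` to `v t`, hence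
an element of degree `d` to itself times `t ^ d`. -/
def degreeHom : SymmetricAlgebra K V →ₐ[K] Polynomial (SymmetricAlgebra K V) :=
  SymmetricAlgebra.lift
    ((Polynomial.monomial 1).restrictScalars K ∘ₗ SymmetricAlgebra.ι K V)

@[simp] lemma degreeHom_ι (v : V) :
    degreeHom (SymmetricAlgebra.ι K V v) = Polynomial.monomial 1 (SymmetricAlgebra.ι K V v) := by
  simp [degreeHom]

/-- The projection of `S(V)` to its homogeneous component of degree `d`. -/
def component (d : ℕ) : SymmetricAlgebra K V →ₗ[K] SymmetricAlgebra K V :=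
  (Polynomial.lcoeff (SymmetricAlgebra K V) d).restrictScalars K ∘ₗ degreeHom.toLinearMap

lemma component_apply (d : ℕ) (f : SymmetricAlgebra K V) :
    component d f = (degreeHom f).coeff d := rfl

lemma degreeHom_of_mem {d : ℕ} {f : SymmetricAlgebra K V} (hf : f ∈ symDegree K V d) :
    degreeHom f = Polynomial.monomial d f := by
  refine Submodule.pow_induction_on_left' (M := LinearMap.range (SymmetricAlgebra.ι K V))
    (C := fun d f _ => degreeHom f = Polynomial.monomial d f) ?_ ?_ ?_ hf
  · intro r
    rw [AlgHom.commutes]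
    rfl
  · intro x y i _ _ hx hy
    rw [map_add, hx, hy, map_add]
  · rintro _ ⟨v, rfl⟩ i x _ hx
    rw [map_mul, hx, degreeHom_ι, Polynomial.monomial_mul_monomial, add_comm]

lemma component_of_mem {d : ℕ} {f : SymmetricAlgebra K V} (hf : f ∈ symDegree K V d) :
    component d f = f := by
  rw [component_apply, degreeHom_of_mem hf, Polynomial.coeff_monomial_same]

lemma component_of_mem_ne {d e : ℕ} {f : SymmetricAlgebra K V} (hf : f ∈ symDegree K V d)
    (h : e ≠ d) : component e f = 0 := by
  rw [component_apply, degreeHom_of_mem hf, Polynomial.coeff_monomial_of_ne _ h]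

lemma component_mul (d : ℕ) (f g : SymmetricAlgebra K V) :
    component d (f * g) = ∑ x ∈ antidiagonal d, component x.1 f * component x.2 g := by
  simp only [component_apply, map_mul, Polynomial.coeff_mul]

lemma mul_mem_symDegree {d e : ℕ} {f g : SymmetricAlgebra K V} (hf : f ∈ symDegree K V d)
    (hg : g ∈ symDegree K V e) : f * g ∈ symDegree K V (d + e) := by
  rw [symDegree, pow_add]
  exact Submodule.mul_mem_mul hf hg

lemma algebraMap_mem_symDegree (c : K) : algebraMap K _ c ∈ symDegree K V 0 := by
  rw [symDegree, pow_zero]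
  exact Submodule.algebraMap_mem c

lemma component_mem (d : ℕ) (f : SymmetricAlgebra K V) : component d f ∈ symDegree K V d := by
  induction f using SymmetricAlgebra.induction generalizing d with
  | algebraMap r =>
    by_cases h : d = 0
    · subst h
      rw [component_of_mem (algebraMap_mem_symDegree r)]
      exact algebraMap_mem_symDegree r
    · rw [component_of_mem_ne (algebraMap_mem_symDegree r) h]
      exact zero_mem _
  | ι v =>
    have hv : SymmetricAlgebra.ι K V v ∈ symDegree K V 1 := by
      rw [symDegree, pow_one]; exact ⟨v, rfl⟩
    by_cases h : d = 1
    · subst h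
      rwa [component_of_mem hv]
    · rw [component_of_mem_ne hv h]
      exact zero_mem _
  | mul a b ha hb =>
    rw [component_mul]
    refine sum_mem fun x hx => ?_
    rw [← mem_antidiagonal.1 hx]
    exact mul_mem_symDegree (ha _) (hb _)
  | add a b ha hb =>
    rw [map_add]
    exact add_mem (ha _) (hb _)

/-- Evaluating `degreeHom f` at `t = 1` recovers `f`, so `f` is the sum of its components. -/
lemma sum_component (f : SymmetricAlgebra K V) :
    ∑ d ∈ range ((degreeHom f).natDegree + 1), component d f = f := by
  have h : ((Polynomial.aeval (R := SymmetricAlgebra K V) (1 : SymmetricAlgebra K V)).restrictScalars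
      K).comp degreeHom = AlgHom.id K (SymmetricAlgebra K V) := by
    apply SymmetricAlgebra.algHom_ext
    ext v
    simp
  have h2 := DFunLike.congr_fun h f
  simp only [AlgHom.comp_apply, AlgHom.restrictScalars_apply, AlgHom.id_apply,
    Polynomial.aeval_eq_sum_range, one_pow, smul_eq_mul, mul_one] at h2
  exact h2

lemma mem_of_component_mem {M : Submodule K (SymmetricAlgebra K V)} {f : SymmetricAlgebra K V}
    (h : ∀ d, component d f ∈ M) : f ∈ M := by
  rw [← sum_component f]
  exact sum_mem fun d _ => h d

lemma component_symMap (φ : V →ₗ[K] W) (d : ℕ) (f : SymmetricAlgebra K V) :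
    component d (symMap φ f) = symMap φ (component d f) := by
  have h : degreeHom.comp (symMap φ) = (Polynomial.mapAlgHom (symMap φ)).comp degreeHom := by
    apply SymmetricAlgebra.algHom_ext
    ext v
    simp
  have h2 := congrArg (fun p => Polynomial.coeff p d) (DFunLike.congr_fun h f)
  simpa [component_apply] using h2

lemma symMap_mem_symDegree (φ : V →ₗ[K] W) {d : ℕ} {f : SymmetricAlgebra K V}
    (hf : f ∈ symDegree K V d) : symMap φ f ∈ symDegree K W d := by
  rw [← component_of_mem hf, ← component_symMap]
  exact component_mem _ _

lemma mem_symDegree_zero {f : SymmetricAlgebra K V} (hf : f ∈ symDegree K V 0) :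
    ∃ c : K, f = algebraMap K _ c := by
  rw [symDegree, pow_zero, Submodule.mem_one] at hf
  exact hf.imp fun c hc => hc.symm

lemma algebraMapInv_of_mem {d : ℕ} (hd : 0 < d) {f : SymmetricAlgebra K V}
    (hf : f ∈ symDegree K V d) : SymmetricAlgebra.algebraMapInv f = 0 := by
  have h := component_symMap (0 : V →ₗ[K] V) d f
  rw [component_of_mem hf, symMap_zero,
    component_of_mem_ne (algebraMap_mem_symDegree _) hd.ne'] at h
  exact (SymmetricAlgebra.algebraMap_eq_zero_iff V _).1 h.symm

lemma component_zero (f : SymmetricAlgebra K V) :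
    component 0 f = algebraMap K _ (SymmetricAlgebra.algebraMapInv f) := by
  obtain ⟨c, hc⟩ := mem_symDegree_zero (component_mem 0 f)
  have h := component_symMap (0 : V →ₗ[K] V) 0 f
  rw [symMap_zero, component_of_mem (algebraMap_mem_symDegree _), hc, AlgHom.commutes] at h
  rw [hc, h]

/-! ### Generators of a graded connected algebra and the decomposable elements -/

/-- The elements with zero constant term of a subalgebra `R` of `S(W)`. -/
def positivePart (R : Subalgebra K (SymmetricAlgebra K W)) :
    Submodule K (SymmetricAlgebra K W) :=
  Subalgebra.toSubmodule R ⊓ LinearMap.ker (SymmetricAlgebra.algebraMapInv (R := K)).toLinearMap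

lemma mem_positivePart {R : Subalgebra K (SymmetricAlgebra K W)} {f : SymmetricAlgebra K W} :
    f ∈ positivePart R ↔ f ∈ R ∧ SymmetricAlgebra.algebraMapInv f = 0 := by
  simp [positivePart]

/-- The decomposable elements of a subalgebra `R` of `S(W)`: the square of the ideal `R₊`. -/
def decomposables (R : Subalgebra K (SymmetricAlgebra K W)) :
    Submodule K (SymmetricAlgebra K W) :=
  positivePart R * positivePart R

lemma sub_algebraMap_mem_positivePart {R : Subalgebra K (SymmetricAlgebra K W)}
    {f : SymmetricAlgebra K W} (hf : f ∈ R) :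
    f - algebraMap K _ (SymmetricAlgebra.algebraMapInv f) ∈ positivePart R := by
  rw [mem_positivePart]
  refine ⟨sub_mem hf (R.algebraMap_mem _), ?_⟩
  rw [map_sub, algebraMapInv_algebraMap, sub_self]

/-- Generators without constant term span `R₊` modulo the decomposable elements. -/
lemma positivePart_adjoin_le {X : Set (SymmetricAlgebra K W)}
    {R : Subalgebra K (SymmetricAlgebra K W)} (hX : X ⊆ positivePart R)
    (hR : Algebra.adjoin K X = R) :
    positivePart R ≤ Submodule.span K X ⊔ decomposables R := by
  have key : ∀ f ∈ Algebra.adjoin K X,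
      f - algebraMap K _ (SymmetricAlgebra.algebraMapInv f) ∈
        Submodule.span K X ⊔ decomposables R := by
    intro f hf
    induction hf using Algebra.adjoin_induction with
    | mem x hx =>
      rw [(mem_positivePart.1 (hX hx)).2, map_zero, sub_zero]
      exact Submodule.mem_sup_left (Submodule.subset_span hx)
    | algebraMap r => simp
    | add x y _ _ hx hy =>
      rw [map_add, map_add, add_sub_add_comm]
      exact add_mem hx hy
    | mul x y hx' hy' hx hy =>
      rw [hR] at hx' hy'
      have : x * y - algebraMap K _ (SymmetricAlgebra.algebraMapInv (x * y)) =
          (x - algebraMap K _ (SymmetricAlgebra.algebraMapInv x)) *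
            (y - algebraMap K _ (SymmetricAlgebra.algebraMapInv y)) +
          (SymmetricAlgebra.algebraMapInv x) •
            (y - algebraMap K _ (SymmetricAlgebra.algebraMapInv y)) +
          (SymmetricAlgebra.algebraMapInv y) •
            (x - algebraMap K _ (SymmetricAlgebra.algebraMapInv x)) := by
        simp only [Algebra.smul_def, map_mul]
        ring
      rw [this]
      exact add_mem (add_mem (Submodule.mem_sup_right (Submodule.mul_mem_mul
        (sub_algebraMap_mem_positivePart hx') (sub_algebraMap_mem_positivePart hy')))
        (Submodule.smul_mem _ _ hy)) (Submodule.smul_mem _ _ hx)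
  intro f hf
  obtain ⟨hf1, hf2⟩ := mem_positivePart.1 hf
  have := key f (hR ▸ hf1)
  rwa [hf2, map_zero, sub_zero] at this

/-- Graded Nakayama lemma: homogeneous elements spanning `R₊` modulo decomposables generate `R`. -/
lemma adjoin_eq_of_positivePart_le {X : Set (SymmetricAlgebra K W)}
    {R : Subalgebra K (SymmetricAlgebra K W)} (hR : ∀ f ∈ R, ∀ d, component d f ∈ R)
    (hXR : X ⊆ R) (hX : ∀ x ∈ X, ∃ d, x ∈ symDegree K W d)
    (h : positivePart R ≤ Submodule.span K X ⊔ decomposables R) :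
    Algebra.adjoin K X = R := by
  refine le_antisymm (Algebra.adjoin_le hXR) ?_
  have key : ∀ d, ∀ f ∈ R, component d f ∈ Algebra.adjoin K X := by
    intro d
    induction d using Nat.strong_induction_on with
    | _ d ih =>
    intro f hf
    rcases Nat.eq_zero_or_pos d with rfl | hd
    · rw [component_zero]
      exact Subalgebra.algebraMap_mem _ _
    · have hpos : component d f ∈ positivePart R :=
        mem_positivePart.2 ⟨hR f hf d, algebraMapInv_of_mem hd (component_mem d f)⟩
      have hle : Submodule.span K X ⊔ decomposables R ≤
          (Subalgebra.toSubmodule (Algebra.adjoin K X)).comap (component d) := by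
        refine sup_le (Submodule.span_le.2 fun x hx => ?_) (Submodule.mul_le.2 fun y hy z hz => ?_)
        · obtain ⟨e, he⟩ := hX x hx
          by_cases hde : d = e
          · subst hde
            simpa [component_of_mem he] using Algebra.subset_adjoin hx
          · simp [component_of_mem_ne he hde]
        · rw [Submodule.mem_comap, component_mul]
          refine sum_mem fun x hx => ?_
          obtain ⟨hy1, hy0⟩ := mem_positivePart.1 hy
          obtain ⟨hz1, hz0⟩ := mem_positivePart.1 hz
          have hx' := mem_antidiagonal.1 hx
          -- the summands with a factor of degree `0` vanish; the others have factors of degree `< d`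
          rcases Nat.eq_zero_or_pos x.1 with h1 | h1
          · rw [h1, component_zero, hy0, map_zero, zero_mul]
            exact zero_mem _
          rcases Nat.eq_zero_or_pos x.2 with h2 | h2
          · rw [h2, component_zero, hz0, map_zero, mul_zero]
            exact zero_mem _
          exact (Algebra.adjoin K X).mul_mem (ih _ (by omega) y hy1) (ih _ (by omega) z hz1)
      have := hle (h hpos)
      rwa [Submodule.mem_comap, component_of_mem (component_mem d f)] at this
  intro f hf
  exact mem_of_component_mem (M := Subalgebra.toSubmodule (Algebra.adjoin K X))
    fun d => key d f hf

/-- A homogeneous generating set of positive degree which is linearly independent modulo the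
decomposable elements is a minimal one. -/
lemma isMinimalHomogeneousGenerating_of_linearIndepOn {X : Set (SymmetricAlgebra K W)}
    {R : Subalgebra K (SymmetricAlgebra K W)}
    (hX : ∀ x ∈ X, ∃ d, 0 < d ∧ x ∈ symDegree K W d)
    (hgen : Algebra.adjoin K X = R) (hli : LinearIndepOn K (decomposables R).mkQ X) :
    IsMinimalHomogeneousGenerating R X where
  homogeneous x hx := (hX x hx).imp fun _ h => h.2
  adjoin_eq := hgen
  minimal T hT hTgen := by
    have hXpos : X ⊆ positivePart R := fun x hx => by
      obtain ⟨d, hd, hxd⟩ := hX x hx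
      exact mem_positivePart.2 ⟨hgen ▸ Algebra.subset_adjoin hx, algebraMapInv_of_mem hd hxd⟩
    obtain ⟨x, hx, hxT⟩ := Set.exists_of_ssubset hT
    have h1 := positivePart_adjoin_le (hT.subset.trans hXpos) hTgen (hXpos hx)
    have h2 : (decomposables R).mkQ x ∈ Submodule.span K ((decomposables R).mkQ '' T) := by
      rw [← Submodule.map_span]
      obtain ⟨s, hs, t, ht, hst⟩ := Submodule.mem_sup.1 h1
      have ht0 : (decomposables R).mkQ t = 0 := (Submodule.Quotient.mk_eq_zero _).2 ht
      exact ⟨s, hs, by rw [← hst, map_add, ht0, add_zero]⟩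
    have h3 := (linearIndepOn_iff_notMem_span.1 hli) x hx
    have hTX : T ⊆ X \ {x} := fun y hy => ⟨hT.subset hy, fun h => hxT (h ▸ hy)⟩
    exact h3 (Submodule.span_mono (Set.image_mono hTX) h2)

/-- Homogeneous elements of positive degree that are linearly independent modulo the
decomposable elements extend to a minimal homogeneous generating system. -/
lemma exists_isMinimalHomogeneousGenerating_of_linearIndepOn {X : Set (SymmetricAlgebra K W)}
    {R : Subalgebra K (SymmetricAlgebra K W)} (hR : ∀ f ∈ R, ∀ d, component d f ∈ R)
    (hXR : X ⊆ R) (hX : ∀ x ∈ X, ∃ d, 0 < d ∧ x ∈ symDegree K W d)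
    (hli : LinearIndepOn K (decomposables R).mkQ X) :
    ∃ S, X ⊆ S ∧ IsMinimalHomogeneousGenerating R S := by
  let H : Set (SymmetricAlgebra K W) := {x | x ∈ R ∧ ∃ d, 0 < d ∧ x ∈ symDegree K W d}
  have hXH : X ⊆ H := fun x hx => ⟨hXR hx, hX x hx⟩
  obtain ⟨S, hSH, hXS, hHS, hS⟩ := exists_linearIndepOn_extension hli hXH
  refine ⟨S, hXS, isMinimalHomogeneousGenerating_of_linearIndepOn (fun x hx => (hSH hx).2) ?_ hS⟩
  refine adjoin_eq_of_positivePart_le hR (fun x hx => (hSH hx).1)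
    (fun x hx => (hSH hx).2.imp fun _ h => h.2) fun f hf => ?_
  obtain ⟨hfR, hf0⟩ := mem_positivePart.1 hf
  refine mem_of_component_mem fun d => ?_
  rcases Nat.eq_zero_or_pos d with rfl | hd
  · rw [component_zero, hf0, map_zero]
    exact zero_mem _
  · have h1 : component d f ∈ H := ⟨hR f hfR d, d, hd, component_mem d f⟩
    have h2 := hHS (Set.mem_image_of_mem _ h1)
    rw [SetLike.mem_coe, ← Submodule.map_span] at h2
    obtain ⟨s, hs, hsf⟩ := h2
    rw [← sub_add_cancel (component d f) s, add_comm]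
    refine Submodule.add_mem_sup hs ?_
    exact (Submodule.Quotient.eq _).1 hsf.symm

/-! ### Symmetrized products and their expression through the elements `[b]` -/

/-- The inclusion `S(V) → S(V^n)` of the `i`-th tensor factor. -/
abbrev factorMap {n : ℕ} (i : Fin n) :
    SymmetricAlgebra K V →ₐ[K] SymmetricAlgebra K (Fin n → V) :=
  symMap (LinearMap.single K (fun _ : Fin n => V) i)

/-- The map `b ↦ [b]` as a linear map. -/
def bracketLin (n : ℕ) : SymmetricAlgebra K V →ₗ[K] SymmetricAlgebra K (Fin n → V) :=
  ∑ i, (factorMap i).toLinearMap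

lemma bracketLin_apply (n : ℕ) (b : SymmetricAlgebra K V) : bracketLin n b = bracket n b := by
  simp [bracketLin, bracket]

/-- The symmetrized product `∑ ι_{s 1}(b_1) ⋯ ι_{s k}(b_k)` over all ways `s` of placing the
factors `b_1, …, b_k` at distinct tensor positions. -/
def placementSum (n : ℕ) {k : ℕ} (b : Fin k → SymmetricAlgebra K V) :
    SymmetricAlgebra K (Fin n → V) :=
  ∑ s : Fin k ↪ Fin n, ∏ j, factorMap (s j) (b j)

/-- Multiplying a symmetrized product by `[b₀]`: the factor `b₀` lands either on a free position
or on one that already carries some `b_j`. -/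
lemma bracket_mul_placementSum (n : ℕ) {k : ℕ} (c : SymmetricAlgebra K V)
    (b : Fin k → SymmetricAlgebra K V) :
    bracket n c * placementSum n b = placementSum n (Fin.cons c b : Fin (k + 1) → _) +
      ∑ j, placementSum n (Function.update b j (c * b j)) := by
  have h1 : placementSum n (Fin.cons c b : Fin (k + 1) → _) =
      ∑ s : Fin k ↪ Fin n, ∑ i : {i // i ∉ Set.range s},
        factorMap (i : Fin n) c * ∏ j, factorMap (s j) (b j) := by
    rw [placementSum, ← (Equiv.embeddingFinSucc k (Fin n)).symm.sum_comp, Fintype.sum_sigma]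
    refine sum_congr rfl fun s _ => sum_congr rfl fun i _ => ?_
    rw [Fin.prod_univ_succ]
    simp
  have h2 : ∑ j, placementSum n (Function.update b j (c * b j)) =
      ∑ s : Fin k ↪ Fin n, ∑ i : {i // i ∈ Set.range s},
        factorMap (i : Fin n) c * ∏ j, factorMap (s j) (b j) := by
    simp only [placementSum]
    rw [sum_comm]
    refine sum_congr rfl fun s _ => ?_
    rw [← (Equiv.ofInjective s s.injective).sum_comp]
    refine sum_congr rfl fun j _ => ?_
    rw [← mul_prod_erase univ _ (mem_univ j), ← mul_prod_erase univ (fun i => factorMap (s i) (b i))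
      (mem_univ j), Function.update_self, map_mul, mul_assoc]
    congr 2
    refine prod_congr rfl fun i hi => ?_
    rw [Function.update_of_ne (ne_of_mem_erase hi)]
  rw [h1, h2, ← sum_add_distrib, placementSum, mul_sum]
  refine sum_congr rfl fun s _ => ?_
  rw [bracket, sum_mul, add_comm]
  convert (Fintype.sum_subtype_add_sum_subtype (fun i => i ∈ Set.range s)
    (fun i => factorMap i c * ∏ j, factorMap (s j) (b j))).symm

/-- Subproducts of the family obtained from `b` by absorbing `c` into its `j`-th member are
subproducts of the family `c, b_1, …, b_k`. -/
lemma exists_prod_update_eq {A : Type*} [CommMonoid A] {k : ℕ} (c : A) (b : Fin k → A) (j : Fin k)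
    (S : Finset (Fin k)) (hS : S.Nonempty) :
    ∃ T : Finset (Fin (k + 1)), T.Nonempty ∧ (T = univ → S = univ) ∧
      ∏ i ∈ S, Function.update b j (c * b j) i = ∏ i ∈ T, (Fin.cons c b : Fin (k + 1) → A) i := by
  by_cases hj : j ∈ S
  · refine ⟨Finset.cons 0 (S.map (Fin.succEmb k)) (by simp [Fin.succ_ne_zero]), by simp, ?_, ?_⟩
    · intro h
      refine eq_univ_of_forall fun i => ?_
      have : i.succ ∈ Finset.cons 0 (S.map (Fin.succEmb k)) _ := h.symm ▸ mem_univ i.succ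
      simpa [Fin.succ_ne_zero] using this
    · rw [prod_cons, prod_map, ← mul_prod_erase S _ hj, Function.update_self, mul_assoc,
        ← mul_prod_erase S (fun i => (Fin.cons c b : Fin (k + 1) → A) (Fin.succEmb k i)) hj]
      simp only [Fin.cons_zero, Fin.coe_succEmb, Fin.cons_succ]
      congr 2
      refine prod_congr rfl fun i hi => ?_
      rw [Function.update_of_ne (ne_of_mem_erase hi)]
  · refine ⟨S.map (Fin.succEmb k), by simpa using hS, ?_, ?_⟩
    · intro h
      have := h ▸ mem_univ (0 : Fin (k + 1))
      simp [Fin.succ_ne_zero] at this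
    · rw [prod_map]
      refine prod_congr rfl fun i hi => ?_
      rw [Function.update_of_ne (show i ≠ j from fun h => hj (h ▸ hi))]
      simp

/-- Symmetrized products lie in any subalgebra containing the elements `[∏_{j ∈ S} b_j]`. -/
lemma placementSum_mem {n : ℕ} (C : Subalgebra K (SymmetricAlgebra K (Fin n → V))) {k : ℕ}
    (b : Fin k → SymmetricAlgebra K V)
    (h : ∀ S : Finset (Fin k), S.Nonempty → bracket n (∏ j ∈ S, b j) ∈ C) :
    placementSum n b ∈ C := by
  induction k with
  | zero => simp [placementSum]
  | succ k ih =>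
    obtain ⟨c, b, rfl⟩ : ∃ c b', b = Fin.cons c b' := ⟨b 0, Fin.tail b, (Fin.cons_self_tail b).symm⟩
    rw [← add_sub_cancel_right (placementSum n (Fin.cons c b : Fin (k + 1) → _))
      (∑ j, placementSum n (Function.update b j (c * b j))), ← bracket_mul_placementSum]
    refine sub_mem (mul_mem ?_ (ih b fun S hS => ?_)) (sum_mem fun j _ => ih _ fun S hS => ?_)
    · simpa using h {0} (singleton_nonempty _)
    · simpa using h (S.map (Fin.succEmb k)) (by simpa using hS)
    · obtain ⟨T, hT, -, hT'⟩ := exists_prod_update_eq c b j S hS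
      rw [hT']
      exact h T hT

/-- Modulo the elements `[∏_{j ∈ S} b_j]` for proper subsets `S`, a symmetrized product of `k + 1`
factors is `(-1)^k k! [b_0 ⋯ b_k]`. -/
lemma placementSum_sub_mem {n : ℕ} (C : Subalgebra K (SymmetricAlgebra K (Fin n → V))) {k : ℕ}
    (b : Fin (k + 1) → SymmetricAlgebra K V)
    (h : ∀ S : Finset (Fin (k + 1)), S.Nonempty → S ≠ univ → bracket n (∏ j ∈ S, b j) ∈ C) :
    placementSum n b - ((-1) ^ k * (k.factorial : K)) • bracket n (∏ j, b j) ∈ C := by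
  induction k with
  | zero =>
    have : placementSum n b = bracket n (∏ j, b j) := by
      have := bracket_mul_placementSum n (b 0) (Fin.tail b)
      rw [Fin.cons_self_tail] at this
      simpa [placementSum] using this.symm
    simp [this]
  | succ k ih =>
    obtain ⟨c, b, rfl⟩ : ∃ c b', b = Fin.cons c b' := ⟨b 0, Fin.tail b, (Fin.cons_self_tail b).symm⟩
    have hprod : ∀ j, ∏ i, Function.update b j (c * b j) i =
        ∏ i, (Fin.cons c b : Fin (k + 1 + 1) → _) i := by
      intro j
      rw [Fin.prod_cons, ← mul_prod_erase univ _ (mem_univ j), Function.update_self,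
        mul_assoc, ← mul_prod_erase univ b (mem_univ j)]
      congr 2
      refine prod_congr rfl fun i hi => ?_
      rw [Function.update_of_ne (ne_of_mem_erase hi)]
    have hsum : ∑ j, (placementSum n (Function.update b j (c * b j)) -
        ((-1) ^ k * (k.factorial : K)) • bracket n (∏ i, Function.update b j (c * b j) i)) ∈ C := by
      refine sum_mem fun j _ => ih _ fun S hS hS' => ?_
      obtain ⟨T, hT, hT', hT''⟩ := exists_prod_update_eq c b j S hS
      rw [hT'']
      exact h T hT fun hu => hS' (hT' hu)
    have hmul : bracket n c * placementSum n b ∈ C := by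
      refine mul_mem ?_ (placementSum_mem C b fun S hS => ?_)
      · simpa using h {0} (singleton_nonempty _) (fun h => by
          have := h ▸ mem_univ (Fin.succ (0 : Fin (k + 1)))
          simp at this)
      · simpa using h (S.map (Fin.succEmb _)) (by simpa using hS) (fun h => by
          have := h ▸ mem_univ (0 : Fin (k + 1 + 1))
          simp [Fin.succ_ne_zero] at this)
    convert sub_mem hmul hsum using 1
    simp only [hprod]
    rw [bracket_mul_placementSum, sum_sub_distrib, sum_const, card_univ, Fintype.card_fin,
      ← Nat.cast_smul_eq_nsmul K, smul_smul, Nat.factorial_succ, pow_succ]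
    have : ((-1 : K) ^ k * -1 * (((k + 1) * k.factorial : ℕ) : K)) =
        -(((k + 1 : ℕ) : K) * ((-1) ^ k * (k.factorial : K))) := by
      push_cast
      ring
    rw [this, neg_smul]
    abel

/-- There is no room for more than `n` factors, so the class of `[b_0 ⋯ b_n]` is expressed by
shorter products. -/
lemma bracket_prod_mem {n : ℕ} (hn : (n.factorial : K) ≠ 0)
    (C : Subalgebra K (SymmetricAlgebra K (Fin n → V)))
    (b : Fin (n + 1) → SymmetricAlgebra K V)
    (h : ∀ S : Finset (Fin (n + 1)), S.Nonempty → S ≠ univ → bracket n (∏ j ∈ S, b j) ∈ C) :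
    bracket n (∏ j, b j) ∈ C := by
  have h0 : placementSum n b = 0 := by
    have : IsEmpty (Fin (n + 1) ↪ Fin n) :=
      Function.Embedding.isEmpty_of_card_lt (by simp)
    simp [placementSum]
  have h1 := placementSum_sub_mem C b h
  rw [h0, zero_sub] at h1
  have hne : ((-1 : K) ^ n * (n.factorial : K)) ≠ 0 := mul_ne_zero (by simp) hn
  have h2 := C.smul_mem (neg_mem h1) ((-1 : K) ^ n * (n.factorial : K))⁻¹
  rwa [neg_neg, smul_smul, inv_mul_cancel₀ hne, one_smul] at h2

/-! ### Invariants of tensor powers -/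

section TensorPower

open PiTensorProduct TensorProduct

variable {n : ℕ} {A : Type*} [CommRing A] [Algebra K A]

/-- Contraction of all tensor factors except the `i`-th against the functionals `φ j`. -/
def tensorSlice (i : Fin n) (φ : Fin n → Module.Dual K A) : (⨂[K] _ : Fin n, A) →ₗ[K] A :=
  lift ((MultilinearMap.mkPiAlgebra K (Fin n) A).compLinearMap
    (Function.update (fun j => Algebra.linearMap K A ∘ₗ φ j) i LinearMap.id))

lemma tensorSlice_tprod (i : Fin n) (φ : Fin n → Module.Dual K A) (x : Fin n → A) :
    tensorSlice i φ (PiTensorProduct.tprod K x) = (∏ j ∈ univ.erase i, φ j (x j)) • x i := by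
  rw [tensorSlice, lift.tprod, MultilinearMap.compLinearMap_apply, MultilinearMap.mkPiAlgebra_apply,
    ← mul_prod_erase univ _ (mem_univ i), Function.update_self, LinearMap.id_apply, mul_comm,
    Algebra.smul_def, map_prod]
  congr 1
  refine prod_congr rfl fun j hj => ?_
  rw [Function.update_of_ne (ne_of_mem_erase hj)]
  rfl

lemma tensorSlice_map_update (i : Fin n) (φ : Fin n → Module.Dual K A) (γ : A →ₗ[K] A)
    (t : ⨂[K] _ : Fin n, A) :
    tensorSlice i φ (PiTensorProduct.map (Function.update (fun _ => LinearMap.id) i γ) t) =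
      γ (tensorSlice i φ t) := by
  suffices h : tensorSlice i φ ∘ₗ
      PiTensorProduct.map (Function.update (fun _ => LinearMap.id) i γ) =
      γ ∘ₗ tensorSlice i φ from DFunLike.congr_fun h t
  ext x
  simp only [LinearMap.compMultilinearMap_apply, LinearMap.comp_apply, map_tprod,
    tensorSlice_tprod, Function.update_self, map_smul]
  congr 1
  refine prod_congr rfl fun j hj => ?_
  rw [Function.update_of_ne (ne_of_mem_erase hj)]
  rfl

lemma tensor_ext_slice (i : Fin n) {s t : ⨂[K] _ : Fin n, A}
    (h : ∀ φ, tensorSlice i φ s = tensorSlice i φ t) : s = t := by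
  let b := Module.Basis.ofVectorSpace K A
  refine (Basis.piTensorProduct fun _ : Fin n => b).ext_elem fun q => ?_
  have key : ∀ u : ⨂[K] _ : Fin n, A, (Basis.piTensorProduct fun _ : Fin n => b).repr u q =
      b.coord (q i) (tensorSlice i (fun j => b.coord (q j)) u) := by
    intro u
    suffices h : (Basis.piTensorProduct fun _ : Fin n => b).coord q =
        b.coord (q i) ∘ₗ tensorSlice i (fun j => b.coord (q j)) from DFunLike.congr_fun h u
    ext x
    simp only [LinearMap.compMultilinearMap_apply, LinearMap.comp_apply, tensorSlice_tprod,
      Module.Basis.coord_apply, Basis.piTensorProduct_repr_tprod_apply, map_smul, smul_eq_mul]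
    rw [← mul_prod_erase univ _ (mem_univ i), mul_comm]
  rw [key, key, h]

/-- If `N` is the space of vectors fixed by the operators `γ`, then a tensor fixed by every `γ`
acting on any single factor lies in the tensor power of `N`. -/
lemma mem_span_tprod_of_fixed {ι : Type*} (γ : ι → A →ₗ[K] A) (N : Submodule K A)
    (hN : ∀ a, (∀ g, γ g a = a) → a ∈ N) (t : ⨂[K] _ : Fin n, A)
    (ht : ∀ i g, PiTensorProduct.map (Function.update (fun _ => LinearMap.id) i (γ g)) t = t) :
    t ∈ Submodule.span K (PiTensorProduct.tprod K '' {x : Fin n → A | ∀ i, x i ∈ N}) := by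
  obtain ⟨r, hr⟩ := N.subtype.exists_leftInverse_of_injective N.ker_subtype
  let p : A →ₗ[K] A := N.subtype ∘ₗ r
  have hp : ∀ a ∈ N, p a = a := fun a ha =>
    congrArg Subtype.val (DFunLike.congr_fun hr (⟨a, ha⟩ : N))
  have h1 : ∀ i, PiTensorProduct.map (Function.update (fun _ => LinearMap.id) i p) t = t := by
    intro i
    refine tensor_ext_slice i fun φ => ?_
    rw [tensorSlice_map_update]
    refine hp _ (hN _ fun g => ?_)
    rw [← tensorSlice_map_update, ht]
  have h2 : ∀ T : Finset (Fin n),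
      PiTensorProduct.map (fun j => if j ∈ T then p else LinearMap.id) t = t := by
    intro T
    induction T using Finset.induction_on with
    | empty => simp
    | insert i T hi ih =>
      have : (fun j => if j ∈ insert i T then p else LinearMap.id) =
          fun j => (Function.update (fun _ => LinearMap.id) i p : Fin n → A →ₗ[K] A) j ∘ₗ
            (if j ∈ T then p else LinearMap.id) := by
        funext j
        by_cases h : j = i
        · subst h
          simp [hi]
        · simp [h]
      rw [this, PiTensorProduct.map_comp, LinearMap.comp_apply, ih, h1]
  have h3 : t ∈ LinearMap.range (PiTensorProduct.map fun _ : Fin n => p) :=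
    ⟨t, by simpa using h2 univ⟩
  rw [map_range_eq_span_tprod] at h3
  refine Submodule.span_mono ?_ h3
  rintro _ ⟨x, rfl⟩
  exact ⟨fun i => p (x i), fun i => (r (x i)).2, rfl⟩

/-- The multiplication map `S(V)^{⊗ n} → S(V^n)`. -/
def tensorMul (n : ℕ) :
    (⨂[K] _ : Fin n, SymmetricAlgebra K V) →ₐ[K] SymmetricAlgebra K (Fin n → V) :=
  liftAlgHom ((MultilinearMap.mkPiAlgebra K (Fin n) (SymmetricAlgebra K (Fin n → V))).compLinearMap
    fun i => (factorMap i).toLinearMap) (by simp) (by simp [prod_mul_distrib])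

lemma tensorMul_tprod (x : Fin n → SymmetricAlgebra K V) :
    tensorMul n (PiTensorProduct.tprod K x) = ∏ i, factorMap i (x i) :=
  lift.tprod _

lemma tensorMul_singleAlgHom (i : Fin n) (a : SymmetricAlgebra K V) :
    tensorMul n (singleAlgHom (R := K) (A := fun _ : Fin n => SymmetricAlgebra K V) i a) =
      factorMap i a := by
  rw [singleAlgHom_apply, tensorMul_tprod, prod_eq_single i]
  · simp
  · intro j _ hj
    simp [hj]
  · simp

/-- The inverse `S(V^n) → S(V)^{⊗ n}` of the multiplication map. -/
def tensorSplit (n : ℕ) :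
    SymmetricAlgebra K (Fin n → V) →ₐ[K] (⨂[K] _ : Fin n, SymmetricAlgebra K V) :=
  SymmetricAlgebra.lift (∑ i, (singleAlgHom i).toLinearMap ∘ₗ SymmetricAlgebra.ι K V ∘ₗ
    LinearMap.proj i)

lemma tensorSplit_ι (v : Fin n → V) :
    tensorSplit n (SymmetricAlgebra.ι K _ v) = ∑ i, singleAlgHom (R := K)
      (A := fun _ : Fin n => SymmetricAlgebra K V) i (SymmetricAlgebra.ι K V (v i)) := by
  simp only [tensorSplit, SymmetricAlgebra.lift_ι_apply, LinearMap.sum_apply]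
  rfl

lemma tensorMul_tensorSplit (f : SymmetricAlgebra K (Fin n → V)) :
    tensorMul n (tensorSplit n f) = f := by
  suffices h : (tensorMul n).comp (tensorSplit n) =
      AlgHom.id K (SymmetricAlgebra K (Fin n → V)) from DFunLike.congr_fun h f
  apply SymmetricAlgebra.algHom_ext
  refine LinearMap.ext fun v => ?_
  change tensorMul n (tensorSplit n (SymmetricAlgebra.ι K _ v)) = SymmetricAlgebra.ι K _ v
  rw [tensorSplit_ι, map_sum]
  simp only [tensorMul_singleAlgHom, symMap_ι]
  rw [← map_sum]
  congr 1
  exact univ_sum_single v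

lemma tensorSplit_tensorMul (t : ⨂[K] _ : Fin n, SymmetricAlgebra K V) :
    tensorSplit n (tensorMul n t) = t := by
  suffices h : (tensorSplit n).comp (tensorMul n) =
      AlgHom.id K (⨂[K] _ : Fin n, SymmetricAlgebra K V) from DFunLike.congr_fun h t
  refine PiTensorProduct.algHom_ext fun i => SymmetricAlgebra.algHom_ext ?_
  refine LinearMap.ext fun v => ?_
  change tensorSplit n (tensorMul n (singleAlgHom i (SymmetricAlgebra.ι K V v))) =
    singleAlgHom i (SymmetricAlgebra.ι K V v)
  rw [tensorMul_singleAlgHom, symMap_ι, tensorSplit_ι, sum_eq_single i]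
  · simp
  · intro j _ hj
    rw [LinearMap.single_apply, Pi.single_eq_of_ne hj, map_zero, map_zero]
  · simp

/-- An operator of `V` acting on one summand of `V^n` acts on the corresponding tensor factor. -/
lemma tensorSplit_symMap_update (i : Fin n) (φ : V →ₗ[K] V) (f : SymmetricAlgebra K (Fin n → V)) :
    tensorSplit n (symMap (LinearMap.pi fun j =>
      (Function.update (fun _ => LinearMap.id) i φ : Fin n → V →ₗ[K] V) j ∘ₗ LinearMap.proj j) f) =
    PiTensorProduct.map (Function.update (fun _ => LinearMap.id) i (symMap φ).toLinearMap)
      (tensorSplit n f) := by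
  set ψ := LinearMap.pi fun j =>
      (Function.update (fun _ => LinearMap.id) i φ : Fin n → V →ₗ[K] V) j ∘ₗ LinearMap.proj j with hψ
  suffices h : (symMap ψ).toLinearMap ∘ₗ (tensorMul n).toLinearMap = (tensorMul n).toLinearMap ∘ₗ
      PiTensorProduct.map (Function.update (fun _ => LinearMap.id) i (symMap φ).toLinearMap) by
    have h' := DFunLike.congr_fun h (tensorSplit n f)
    simp only [LinearMap.comp_apply, AlgHom.toLinearMap_apply, tensorMul_tensorSplit] at h'
    rw [h', tensorSplit_tensorMul]
  ext x
  simp only [LinearMap.compMultilinearMap_apply, LinearMap.comp_apply, map_tprod,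
    AlgHom.toLinearMap_apply, tensorMul_tprod, map_prod]
  refine prod_congr rfl fun j _ => ?_
  have hj : ψ ∘ₗ LinearMap.single K (fun _ : Fin n => V) j = LinearMap.single K _ j ∘ₗ
      (Function.update (fun _ => LinearMap.id) i φ : Fin n → V →ₗ[K] V) j := by
    refine LinearMap.ext fun v => funext fun l => ?_
    rcases eq_or_ne l j with rfl | hl
    · simp [hψ]
    · simp [hψ, hl]
  rw [symMap_symMap, hj, ← symMap_symMap]
  rcases eq_or_ne j i with rfl | hji
  · simp
  · simp [hji, symMap_id]

end TensorPower

/-! ### Invariants of the wreath product -/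

section Wreath

variable {G : Type*} [Group G] (ρ : Representation K G V) {n : ℕ}

lemma component_mem_polyInvariants {f : SymmetricAlgebra K V} (hf : f ∈ polyInvariants ρ) (d : ℕ) :
    component d f ∈ polyInvariants ρ := fun g => by
  rw [← component_symMap, hf g]

lemma wreathRep_comp_single (x : WreathProduct G n) (i : Fin n) :
    wreathRep ρ n x ∘ₗ LinearMap.single K (fun _ : Fin n => V) i =
      LinearMap.single K (fun _ : Fin n => V) (x.right i) ∘ₗ ρ (x.left (x.right i)) := by
  refine LinearMap.ext fun v => funext fun l => ?_
  change ρ (x.left l) (Pi.single (M := fun _ : Fin n => V) i v (x.right⁻¹ l)) =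
    Pi.single (M := fun _ : Fin n => V) (x.right i) (ρ (x.left (x.right i)) v) l
  by_cases h : l = x.right i
  · subst h
    simp
  · have h' : x.right⁻¹ l ≠ i := fun h' => h <| by
      rw [← h']
      exact (x.right.apply_symm_apply l).symm
    rw [Pi.single_eq_of_ne h, Pi.single_eq_of_ne h', map_zero]

lemma symMap_wreathRep_factorMap (x : WreathProduct G n) (i : Fin n) (b : SymmetricAlgebra K V) :
    symMap (wreathRep ρ n x) (factorMap i b) =
      factorMap (x.right i) (symMap (ρ (x.left (x.right i))) b) := by
  rw [symMap_symMap, wreathRep_comp_single, ← symMap_symMap]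

lemma bracket_mem_polyInvariants {b : SymmetricAlgebra K V} (hb : b ∈ polyInvariants ρ) :
    bracket n b ∈ polyInvariants (wreathRep ρ n) := fun x => by
  rw [bracket, map_sum, ← Equiv.sum_comp x.right (fun i => factorMap i b)]
  refine sum_congr rfl fun i _ => ?_
  rw [symMap_wreathRep_factorMap, hb]

/-- Invariance under the subgroup `G^n` alone confines `f` to the `n`-th tensor power of `S(V)^G`. -/
lemma mem_span_prod_factorMap {f : SymmetricAlgebra K (Fin n → V)}
    (hf : f ∈ polyInvariants (wreathRep ρ n)) :
    f ∈ Submodule.span K ((fun a : Fin n → SymmetricAlgebra K V => ∏ i, factorMap i (a i)) ''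
      {a | ∀ i, a i ∈ polyInvariants ρ}) := by
  have h := mem_span_tprod_of_fixed (fun g => (symMap (ρ g)).toLinearMap)
    (Subalgebra.toSubmodule (polyInvariants ρ)) (fun a ha => ha) (tensorSplit n f) fun i g => by
      rw [← tensorSplit_symMap_update]
      congr 1
      convert hf ⟨Function.update 1 i g, 1⟩ using 2
      refine congrArg symMap (LinearMap.ext fun v => funext fun j => ?_)
      change (Function.update (fun _ => LinearMap.id) i (ρ g) : Fin n → V →ₗ[K] V) j (v j) =
        ρ ((Function.update 1 i g : Fin n → G) j) (v j)
      rcases eq_or_ne j i with rfl | hj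
      · simp
      · simp [hj]
  have h2 := Submodule.mem_map_of_mem (f := (tensorMul n).toLinearMap) h
  rw [Submodule.map_span, AlgHom.toLinearMap_apply, tensorMul_tensorSplit] at h2
  refine Submodule.span_mono ?_ h2
  rintro _ ⟨_, ⟨a, ha, rfl⟩, rfl⟩
  exact ⟨a, ha, (tensorMul_tprod a).symm⟩

lemma sum_symMap_wreathRep_prod (a : Fin n → SymmetricAlgebra K V) :
    ∑ σ : Equiv.Perm (Fin n), symMap (wreathRep ρ n ⟨1, σ⟩) (∏ i, factorMap i (a i)) =
      placementSum n a := by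
  rw [placementSum, ← Equiv.sum_comp (Equiv.embeddingEquivOfFinite (Fin n)).symm]
  refine sum_congr rfl fun σ _ => ?_
  rw [map_prod]
  refine prod_congr rfl fun i _ => ?_
  rw [symMap_wreathRep_factorMap]
  simp [symMap_id, Module.End.one_eq_id]

/-- Averaging over `S_n` shows that the invariants of the wreath product are generated by the
elements `[a]` with `a ∈ S(V)^G`. -/
lemma polyInvariants_wreathRep_le (hn : (n.factorial : K) ≠ 0)
    (C : Subalgebra K (SymmetricAlgebra K (Fin n → V)))
    (hC : ∀ a ∈ polyInvariants ρ, bracket n a ∈ C) :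
    polyInvariants (wreathRep ρ n) ≤ C := by
  intro f hf
  let avg : SymmetricAlgebra K (Fin n → V) →ₗ[K] SymmetricAlgebra K (Fin n → V) :=
    ∑ σ : Equiv.Perm (Fin n), (symMap (wreathRep ρ n ⟨1, σ⟩)).toLinearMap
  have h1 : avg f = (n.factorial : K) • f := by
    have : ∀ σ : Equiv.Perm (Fin n), symMap (wreathRep ρ n ⟨1, σ⟩) f = f := fun σ => hf _
    simp only [avg, LinearMap.sum_apply, AlgHom.toLinearMap_apply, this, sum_const, card_univ,
      Fintype.card_perm, Fintype.card_fin, Nat.cast_smul_eq_nsmul]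
  have h2 : avg f ∈ C := by
    have h3 := Submodule.mem_map_of_mem (f := avg) (mem_span_prod_factorMap ρ hf)
    rw [Submodule.map_span] at h3
    refine (Submodule.span_le (p := Subalgebra.toSubmodule C)).2 ?_ h3
    rintro _ ⟨_, ⟨a, ha, rfl⟩, rfl⟩
    have : avg (∏ i, factorMap i (a i)) = placementSum n a := by
      rw [← sum_symMap_wreathRep_prod ρ a]
      simp [avg]
    simp only [SetLike.mem_coe, Subalgebra.mem_toSubmodule]
    rw [this]
    exact placementSum_mem C a fun S _ => hC _ (prod_mem fun j _ => ha j)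
  rw [h1] at h2
  have h4 := C.smul_mem h2 (n.factorial : K)⁻¹
  rwa [smul_smul, inv_mul_cancel₀ hn, one_smul] at h4

lemma adjoin_bracket_eq (hn : (n.factorial : K) ≠ 0) {X : Set (SymmetricAlgebra K V)}
    (hX : X ⊆ polyInvariants ρ)
    (h : ∀ d, ∀ a ∈ invariantsDegree ρ d, bracket n a ∈ Algebra.adjoin K (bracket n '' X)) :
    Algebra.adjoin K (bracket n '' X) = polyInvariants (wreathRep ρ n) := by
  refine le_antisymm (Algebra.adjoin_le ?_) (polyInvariants_wreathRep_le ρ hn _ fun a ha => ?_)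
  · rintro _ ⟨b, hb, rfl⟩
    exact bracket_mem_polyInvariants ρ (hX hb)
  · have : a ∈ (Subalgebra.toSubmodule (Algebra.adjoin K (bracket n '' X))).comap (bracketLin n) :=
      mem_of_component_mem fun d => by
        rw [Submodule.mem_comap, bracketLin_apply]
        exact h d _ ⟨component_mem_polyInvariants ρ ha d, component_mem d a⟩
    rwa [Submodule.mem_comap, bracketLin_apply] at this

end Wreath

/-! ### A linear functional separating the elements `[b]` from the decomposable elements -/

lemma natCast_ne_zero_of_le {n : ℕ} (hK : ringChar K = 0 ∨ n < ringChar K) {m : ℕ} (hm : 0 < m)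
    (hmn : m ≤ n) : (m : K) ≠ 0 := by
  intro h
  have h1 := (ringChar.spec K m).1 h
  rcases hK with h0 | h0
  · rw [h0, zero_dvd_iff] at h1
    omega
  · have := Nat.le_of_dvd hm h1
    omega

lemma factorial_ne_zero_of_ringChar {n : ℕ} (hK : ringChar K = 0 ∨ n < ringChar K) :
    (n.factorial : K) ≠ 0 := by
  rw [← prod_range_add_one_eq_factorial, Nat.cast_prod]
  exact prod_ne_zero_iff.2 fun i hi =>
    natCast_ne_zero_of_le hK i.succ_pos (Nat.succ_le_of_lt (mem_range.1 hi))

/-- On polynomials of degree at most `n`, the coefficient of `t` is a linear combination of the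
values at `0, 1, …, n`. -/
lemma exists_linear_coeff_weights {n : ℕ} (hK : ringChar K = 0 ∨ n < ringChar K) :
    ∃ c : Fin (n + 1) → K, ∀ j ≤ n, ∑ k, c k * ((k : ℕ) : K) ^ j = if j = 1 then 1 else 0 := by
  let A : Matrix (Fin (n + 1)) (Fin (n + 1)) K := Matrix.vandermonde fun k => ((k : ℕ) : K)
  have hA : IsUnit A.det := by
    rw [isUnit_iff_ne_zero, Matrix.det_vandermonde_ne_zero_iff]
    have key : ∀ a b : Fin (n + 1), a < b → ((a : ℕ) : K) ≠ ((b : ℕ) : K) := by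
      intro a b hab h
      have hab' : (a : ℕ) < b := hab
      refine natCast_ne_zero_of_le hK (m := b - a) (by omega) (by omega) ?_
      rw [Nat.cast_sub hab'.le, h, sub_self]
    intro a b hab
    rcases lt_trichotomy a b with h | h | h
    · exact absurd hab (key a b h)
    · exact h
    · exact absurd hab.symm (key b a h)
  let e : Fin (n + 1) → K := fun j => if (j : ℕ) = 1 then 1 else 0
  refine ⟨Matrix.vecMul e A⁻¹, fun j hj => ?_⟩
  have h : Matrix.vecMul (Matrix.vecMul e A⁻¹) A = e := by
    rw [Matrix.vecMul_vecMul, Matrix.nonsing_inv_mul A hA, Matrix.vecMul_one]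
  exact congrFun h ⟨j, Nat.lt_succ_of_le hj⟩

/-- The sum of the first `k` coordinates, as a map `V^n → V`. -/
def partialSum (n k : ℕ) : (Fin n → V) →ₗ[K] V :=
  ∑ i ∈ univ.filter fun i : Fin n => (i : ℕ) < k, LinearMap.proj i

lemma partialSum_comp_single (n k : ℕ) (i : Fin n) :
    partialSum n k ∘ₗ LinearMap.single K (fun _ : Fin n => V) i =
      if (i : ℕ) < k then LinearMap.id else 0 := by
  refine LinearMap.ext fun v => ?_
  simp only [partialSum, LinearMap.comp_apply, LinearMap.sum_apply, LinearMap.proj_apply,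
    LinearMap.single_apply]
  split_ifs with h
  · rw [sum_eq_single_of_mem i (by simpa using h) fun j _ hj => by rw [Pi.single_eq_of_ne hj]]
    simp
  · refine sum_eq_zero fun j hj => ?_
    rw [Pi.single_eq_of_ne]
    rintro rfl
    exact h (by simpa using hj)

lemma symMap_partialSum_bracket {n k : ℕ} (hk : k ≤ n) {a : SymmetricAlgebra K V}
    (ha : SymmetricAlgebra.algebraMapInv a = 0) :
    symMap (partialSum n k) (bracket n a) = (k : SymmetricAlgebra K V) * a := by
  have h : ∀ i : Fin n, symMap (partialSum n k) (factorMap i a) =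
      if (i : ℕ) < k then a else 0 := by
    intro i
    rw [symMap_symMap, partialSum_comp_single]
    split_ifs
    · rw [symMap_id, AlgHom.id_apply]
    · rw [symMap_zero, ha, map_zero]
  rw [bracket, map_sum, sum_congr rfl fun i _ => h i, ← sum_filter, sum_const, nsmul_eq_mul,
    Fin.card_filter_val_lt, min_eq_right hk]

/-- Elements of `S(V)` all of whose homogeneous components have degree at least `m`. -/
def orderGE (K V : Type*) [Field K] [AddCommGroup V] [Module K V] (m : ℕ) :
    Submodule K (SymmetricAlgebra K V) :=
  ⨅ d : Fin m, LinearMap.ker (component (d : ℕ))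

lemma mem_orderGE {m : ℕ} {f : SymmetricAlgebra K V} :
    f ∈ orderGE K V m ↔ ∀ d < m, component d f = 0 := by
  simp only [orderGE, Submodule.mem_iInf, LinearMap.mem_ker]
  exact ⟨fun h d hd => h ⟨d, hd⟩, fun h d => h d d.2⟩

lemma orderGE_antitone {a b : ℕ} (h : a ≤ b) : orderGE K V b ≤ orderGE K V a :=
  fun _ hf => mem_orderGE.2 fun d hd => mem_orderGE.1 hf d (hd.trans_le h)

lemma mul_mem_orderGE {a b : ℕ} {f g : SymmetricAlgebra K V} (hf : f ∈ orderGE K V a)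
    (hg : g ∈ orderGE K V b) : f * g ∈ orderGE K V (a + b) := by
  refine mem_orderGE.2 fun d hd => ?_
  rw [component_mul]
  refine sum_eq_zero fun x hx => ?_
  have hx' := mem_antidiagonal.1 hx
  rcases lt_or_ge x.1 a with h | h
  · rw [mem_orderGE.1 hf _ h, zero_mul]
  · rw [mem_orderGE.1 hg _ (by omega), mul_zero]

lemma orderGE_zero : orderGE K V 0 = ⊤ := by
  simp [orderGE]

section

variable {G : Type*} [Group G] (ρ : Representation K G V) {n : ℕ}

lemma adjoin_bracket_positivePart (hn : (n.factorial : K) ≠ 0) :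
    Algebra.adjoin K (bracket n '' (positivePart (polyInvariants ρ) : Set (SymmetricAlgebra K V))) =
      polyInvariants (wreathRep ρ n) := by
  refine adjoin_bracket_eq ρ hn (fun a ha => (mem_positivePart.1 ha).1) fun d a ha => ?_
  rcases Nat.eq_zero_or_pos d with rfl | hd
  · obtain ⟨c, rfl⟩ := mem_symDegree_zero ha.2
    simp only [bracket, AlgHom.commutes]
    exact sum_mem fun _ _ => Subalgebra.algebraMap_mem _ _
  · exact Algebra.subset_adjoin ⟨a, mem_positivePart.2 ⟨ha.1, algebraMapInv_of_mem hd ha.2⟩, rfl⟩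

lemma mem_orderGE_of_mem_positivePart {q : ℕ}
    (hq : ∀ d, 0 < d → d < q → invariantsDegree ρ d = ⊥) {a : SymmetricAlgebra K V}
    (ha : a ∈ positivePart (polyInvariants ρ)) : a ∈ orderGE K V q := by
  obtain ⟨ha1, ha2⟩ := mem_positivePart.1 ha
  refine mem_orderGE.2 fun d hd => ?_
  rcases Nat.eq_zero_or_pos d with rfl | hd0
  · rw [component_zero, ha2, map_zero]
  · have : component d a ∈ invariantsDegree ρ d :=
      ⟨component_mem_polyInvariants ρ ha1 d, component_mem d a⟩
    rwa [hq d hd0 hd, Submodule.mem_bot] at this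

/-- The values of the homomorphisms `[a] ↦ k a` at an invariant depend polynomially on `k`, and the
coefficient of `k ^ j` has degree at least `j q`. -/
lemma exists_interpolating_polynomial (hn : (n.factorial : K) ≠ 0) {q : ℕ}
    (hq : ∀ d, 0 < d → d < q → invariantsDegree ρ d = ⊥) {f : SymmetricAlgebra K (Fin n → V)}
    (hf : f ∈ polyInvariants (wreathRep ρ n)) :
    ∃ P : Polynomial (SymmetricAlgebra K V),
      (∀ k ≤ n, P.eval (k : SymmetricAlgebra K V) = symMap (partialSum n k) f) ∧
      ∀ j, P.coeff j ∈ orderGE K V (j * q) := by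
  rw [← adjoin_bracket_positivePart ρ hn] at hf
  induction hf using Algebra.adjoin_induction with
  | mem x hx =>
    obtain ⟨a, ha, rfl⟩ := hx
    refine ⟨Polynomial.monomial 1 a, fun k hk => ?_, fun j => ?_⟩
    · rw [symMap_partialSum_bracket hk (mem_positivePart.1 ha).2, Polynomial.eval_monomial,
        pow_one, mul_comm]
    · rw [Polynomial.coeff_monomial]
      split_ifs with h
      · rw [← h, one_mul]
        exact mem_orderGE_of_mem_positivePart ρ hq ha
      · exact zero_mem _
  | algebraMap r =>
    refine ⟨Polynomial.C (algebraMap K _ r), fun k _ => by simp, fun j => ?_⟩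
    rw [Polynomial.coeff_C]
    split_ifs with h
    · rw [h, zero_mul, orderGE_zero]
      exact Submodule.mem_top
    · exact zero_mem _
  | add x y _ _ hx hy =>
    obtain ⟨P, hP, hP'⟩ := hx
    obtain ⟨Q, hQ, hQ'⟩ := hy
    refine ⟨P + Q, fun k hk => ?_, fun j => ?_⟩
    · rw [Polynomial.eval_add, hP k hk, hQ k hk, map_add]
    · rw [Polynomial.coeff_add]
      exact add_mem (hP' j) (hQ' j)
  | mul x y _ _ hx hy =>
    obtain ⟨P, hP, hP'⟩ := hx
    obtain ⟨Q, hQ, hQ'⟩ := hy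
    refine ⟨P * Q, fun k hk => ?_, fun j => ?_⟩
    · rw [Polynomial.eval_mul, hP k hk, hQ k hk, map_mul]
    · rw [Polynomial.coeff_mul]
      refine sum_mem fun x hx => ?_
      rw [← mem_antidiagonal.1 hx, add_mul]
      exact mul_mem_orderGE (hP' _) (hQ' _)

/-- The weighted sum of the homomorphisms `[a] ↦ k a`, `k = 0, …, n`. -/
def weightedSum (n : ℕ) (c : Fin (n + 1) → K) :
    SymmetricAlgebra K (Fin n → V) →ₗ[K] SymmetricAlgebra K V :=
  ∑ k : Fin (n + 1), c k • (symMap (partialSum n k)).toLinearMap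

lemma weightedSum_apply (c : Fin (n + 1) → K) (f : SymmetricAlgebra K (Fin n → V)) :
    weightedSum n c f = ∑ k : Fin (n + 1), c k • symMap (partialSum n k) f := by
  simp [weightedSum]

lemma weightedSum_bracket (hn : 0 < n) {c : Fin (n + 1) → K}
    (hc : ∀ j ≤ n, ∑ k, c k * ((k : ℕ) : K) ^ j = if j = 1 then 1 else 0)
    {a : SymmetricAlgebra K V} (ha : SymmetricAlgebra.algebraMapInv a = 0) :
    weightedSum n c (bracket n a) = a := by
  have h : ∀ k : Fin (n + 1), c k • symMap (partialSum n k) (bracket n a) =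
      (c k * ((k : ℕ) : K) ^ 1) • a := by
    intro k
    rw [symMap_partialSum_bracket (Nat.le_of_lt_succ k.2) ha, mul_smul, pow_one,
      Nat.cast_smul_eq_nsmul, nsmul_eq_mul]
  rw [weightedSum_apply, sum_congr rfl fun k _ => h k, ← sum_smul, hc 1 hn, if_pos rfl, one_smul]

/-- The constant and linear coefficients of the polynomial attached to a decomposable element
vanish; the weights kill the coefficients of degrees `2, …, n`, and the rest has high degree. -/
lemma weightedSum_mem_orderGE (hn : (n.factorial : K) ≠ 0) {c : Fin (n + 1) → K}
    (hc : ∀ j ≤ n, ∑ k, c k * ((k : ℕ) : K) ^ j = if j = 1 then 1 else 0) {q : ℕ}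
    (hq : ∀ d, 0 < d → d < q → invariantsDegree ρ d = ⊥) {f : SymmetricAlgebra K (Fin n → V)}
    (hf : f ∈ decomposables (polyInvariants (wreathRep ρ n))) :
    weightedSum n c f ∈ orderGE K V ((n + 1) * q) := by
  refine (Submodule.mul_le (P := (orderGE K V ((n + 1) * q)).comap (weightedSum n c))).2 ?_ hf
  intro y hy z hz
  obtain ⟨hy1, hy0⟩ := mem_positivePart.1 hy
  obtain ⟨hz1, hz0⟩ := mem_positivePart.1 hz
  obtain ⟨P, hP, hP'⟩ := exists_interpolating_polynomial ρ hn hq hy1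
  obtain ⟨Q, hQ, hQ'⟩ := exists_interpolating_polynomial ρ hn hq hz1
  have hzero : partialSum n 0 = (0 : (Fin n → V) →ₗ[K] V) := by simp [partialSum]
  have hP0 : P.coeff 0 = 0 := by
    have := hP 0 (Nat.zero_le n)
    rwa [hzero, symMap_zero, hy0, map_zero, Nat.cast_zero, ← Polynomial.coeff_zero_eq_eval_zero]
      at this
  have hQ0 : Q.coeff 0 = 0 := by
    have := hQ 0 (Nat.zero_le n)
    rwa [hzero, symMap_zero, hz0, map_zero, Nat.cast_zero, ← Polynomial.coeff_zero_eq_eval_zero]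
      at this
  have hPQ1 : (P * Q).coeff 1 = 0 := by
    rw [Polynomial.coeff_mul, Nat.sum_antidiagonal_eq_sum_range_succ_mk]
    simp [sum_range_succ, hP0, hQ0]
  have hterm : ∀ k : Fin (n + 1), c k • symMap (partialSum n k) (y * z) =
      ∑ j ∈ range ((P * Q).natDegree + 1), (c k * ((k : ℕ) : K) ^ j) • (P * Q).coeff j := by
    intro k
    have hk := Nat.le_of_lt_succ k.2
    rw [map_mul, ← hP k hk, ← hQ k hk, ← Polynomial.eval_mul, Polynomial.eval_eq_sum_range,
      smul_sum]
    refine sum_congr rfl fun j _ => ?_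
    rw [mul_smul, Algebra.smul_def (((k : ℕ) : K) ^ j), map_pow, map_natCast, mul_comm]
  rw [Submodule.mem_comap, weightedSum_apply, sum_congr rfl fun k _ => hterm k, sum_comm]
  refine sum_mem fun j _ => ?_
  rw [← sum_smul]
  rcases le_or_gt j n with hj | hj
  · rw [hc j hj]
    split_ifs with h1
    · rw [h1, hPQ1, smul_zero]
      exact zero_mem _
    · rw [zero_smul]
      exact zero_mem _
  · refine Submodule.smul_mem _ _ ?_
    rw [Polynomial.coeff_mul]
    refine sum_mem fun x hx => orderGE_antitone (Nat.mul_le_mul_right q hj) ?_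
    rw [← mem_antidiagonal.1 hx, add_mul]
    exact mul_mem_orderGE (hP' _) (hQ' _)

/-- Truncation of `S(V)` to the degrees below `m`. -/
def truncLT (K V : Type*) [Field K] [AddCommGroup V] [Module K V] (m : ℕ) :
    SymmetricAlgebra K V →ₗ[K] SymmetricAlgebra K V :=
  ∑ d ∈ range m, component d

lemma truncLT_of_mem_orderGE {m : ℕ} {f : SymmetricAlgebra K V} (hf : f ∈ orderGE K V m) :
    truncLT K V m f = 0 := by
  rw [truncLT, LinearMap.sum_apply]
  exact sum_eq_zero fun d hd => mem_orderGE.1 hf d (mem_range.1 hd)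

lemma truncLT_of_mem {m d : ℕ} (hd : d < m) {f : SymmetricAlgebra K V}
    (hf : f ∈ symDegree K V d) : truncLT K V m f = f := by
  rw [truncLT, LinearMap.sum_apply, sum_eq_single d, component_of_mem hf]
  · exact fun e _ he => component_of_mem_ne hf he
  · exact fun h => absurd (mem_range.2 hd) h

lemma linearIndepOn_iUnion_of_homogeneous {𝓑 : ℕ → Set (SymmetricAlgebra K V)}
    (h1 : ∀ d, LinearIndepOn K id (𝓑 d)) (h2 : ∀ d, 𝓑 d ⊆ symDegree K V d) :
    LinearIndepOn K id (⋃ d, 𝓑 d) := by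
  refine linearIndepOn_id_iUnion_finite h1 fun d t _ hd => Submodule.disjoint_def.2 fun x hx hx' => ?_
  rw [← component_of_mem (Submodule.span_le.2 (h2 d) hx)]
  have : ⨆ i ∈ t, Submodule.span K (𝓑 i) ≤ LinearMap.ker (component d) := by
    refine iSup₂_le fun i hi => Submodule.span_le.2 fun y hy => ?_
    exact component_of_mem_ne (h2 i hy) fun h => hd (h ▸ hi)
  exact this hx'

/-- Linearly independent invariants of degrees below `(n + 1) q` yield elements `[b]` which are
linearly independent modulo the decomposable elements. -/
lemma linearIndepOn_mkQ_bracket (hn : 0 < n) (hK : ringChar K = 0 ∨ n < ringChar K) {q : ℕ}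
    (hq : ∀ d, 0 < d → d < q → invariantsDegree ρ d = ⊥) {B : Set (SymmetricAlgebra K V)}
    (hB : ∀ b ∈ B, ∃ d, 0 < d ∧ d < (n + 1) * q ∧ b ∈ symDegree K V d)
    (hli : LinearIndepOn K id B) :
    LinearIndepOn K (decomposables (polyInvariants (wreathRep ρ n))).mkQ (bracket n '' B) := by
  obtain ⟨c, hc⟩ := exists_linear_coeff_weights hK
  let Ψ := truncLT K V ((n + 1) * q) ∘ₗ weightedSum n c
  have hΨ : decomposables (polyInvariants (wreathRep ρ n)) ≤ LinearMap.ker Ψ := fun f hf =>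
    truncLT_of_mem_orderGE
      (weightedSum_mem_orderGE ρ (factorial_ne_zero_of_ringChar hK) hc hq hf)
  refine LinearIndepOn.of_comp (Submodule.liftQ _ Ψ hΨ) (LinearIndepOn.image_of_comp _ _ ?_)
  refine hli.congr fun b hb => ?_
  obtain ⟨d, hd, hdq, hbd⟩ := hB b hb
  change b = truncLT K V ((n + 1) * q) (weightedSum n c (bracket n b))
  rw [weightedSum_bracket hn hc (algebraMapInv_of_mem hd hbd), truncLT_of_mem hdq hbd]

end

/-! ### Invariant rings generated in a single degree -/

section

variable {G : Type*} [Group G] (ρ : Representation K G V) {n : ℕ}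

lemma prod_mem_invariantsDegree {ι : Type*} (S : Finset ι) (e : ι → ℕ)
    (b : ι → SymmetricAlgebra K V) (h : ∀ i ∈ S, b i ∈ invariantsDegree ρ (e i)) :
    ∏ i ∈ S, b i ∈ invariantsDegree ρ (∑ i ∈ S, e i) := by
  classical
  induction S using Finset.induction_on with
  | empty => exact ⟨one_mem (polyInvariants ρ), by simpa using algebraMap_mem_symDegree (V := V) (1 : K)⟩
  | insert i S hi ih =>
    rw [prod_insert hi, sum_insert hi]
    obtain ⟨h1, h2⟩ := h i (mem_insert_self i S)
    obtain ⟨h3, h4⟩ := ih fun j hj => h j (mem_insert_of_mem hj)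
    exact ⟨mul_mem (S := Subalgebra K _) h1 h3, mul_mem_symDegree h2 h4⟩

/-- If `S(V)^G` is generated in degree `q`, then any `[a]` is a polynomial in the elements `[b]`
with `b` an invariant of degree less than `(n + 1) q`. -/
lemma bracket_mem_of_generated_in_degree (hn : (n.factorial : K) ≠ 0) {q : ℕ} (hq : 0 < q)
    (hgen : Algebra.adjoin K (invariantsDegree ρ q : Set (SymmetricAlgebra K V)) =
      polyInvariants ρ)
    (C : Subalgebra K (SymmetricAlgebra K (Fin n → V)))
    (hC : ∀ d, 0 < d → d < (n + 1) * q → ∀ a ∈ invariantsDegree ρ d, bracket n a ∈ C) (d : ℕ) :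
    ∀ a ∈ invariantsDegree ρ d, bracket n a ∈ C := by
  induction d using Nat.strong_induction_on with
  | _ d ih =>
  rcases Nat.eq_zero_or_pos d with rfl | hd
  · intro a ha
    obtain ⟨c, rfl⟩ := mem_symDegree_zero ha.2
    simp only [bracket, AlgHom.commutes]
    exact sum_mem fun _ _ => Subalgebra.algebraMap_mem _ _
  rcases lt_or_ge d ((n + 1) * q) with hdq | hdq
  · exact hC d hd hdq
  have key : Subalgebra.toSubmodule (polyInvariants ρ) ≤
      (Subalgebra.toSubmodule C).comap (bracketLin n ∘ₗ component d) := by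
    rw [← hgen, Algebra.adjoin_eq_span, Submodule.span_le]
    intro m hm
    obtain ⟨l, hl, rfl⟩ := Submonoid.exists_list_of_mem_closure hm
    obtain ⟨k, f, rfl⟩ : ∃ k, ∃ f : Fin k → SymmetricAlgebra K V, l = List.ofFn f :=
      ⟨l.length, l.get, (List.ofFn_get l).symm⟩
    have hf : ∀ i, f i ∈ invariantsDegree ρ q := fun i =>
      hl _ ((List.mem_ofFn' _ _).2 ⟨i, rfl⟩)
    rw [List.prod_ofFn, SetLike.mem_coe, Submodule.mem_comap, LinearMap.comp_apply,
      bracketLin_apply, Subalgebra.mem_toSubmodule]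
    have hdeg := prod_mem_invariantsDegree ρ univ (fun _ => q) f fun i _ => hf i
    rw [sum_const, card_univ, Fintype.card_fin, smul_eq_mul] at hdeg
    by_cases hkd : d = k * q
    · have hnk : n + 1 ≤ k := Nat.le_of_mul_le_mul_right (hkd ▸ hdq) hq
      obtain ⟨r, rfl⟩ : ∃ r, k = n + (r + 1) := ⟨k - n - 1, by omega⟩
      rw [component_of_mem (hkd ▸ hdeg.2), Fin.prod_univ_add]
      -- group the product into `n + 1` factors of positive degree
      let b : Fin (n + 1) → SymmetricAlgebra K V :=
        Fin.snoc (fun i => f (Fin.castAdd (r + 1) i)) (∏ j, f (Fin.natAdd n j))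
      let e : Fin (n + 1) → ℕ := Fin.snoc (fun _ => q) ((r + 1) * q)
      have hb : ∀ i, b i ∈ invariantsDegree ρ (e i) := by
        intro i
        induction i using Fin.lastCases with
        | last =>
          have := prod_mem_invariantsDegree ρ univ (fun _ => q) (fun j => f (Fin.natAdd n j))
            fun i _ => hf _
          simpa [b, e] using this
        | cast i => simpa [b, e] using hf _
      have he : ∀ i, 0 < e i := by
        intro i
        induction i using Fin.lastCases with
        | last => simpa [e] using hq
        | cast i => simpa [e] using hq
      have hsum : ∑ i, e i = d := by
        rw [Fin.sum_univ_castSucc, hkd]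
        simp [e]
        ring
      have hprod : ∏ i, b i =
          (∏ i, f (Fin.castAdd (r + 1) i)) * ∏ j, f (Fin.natAdd n j) := by
        rw [Fin.prod_univ_castSucc]
        simp [b]
      rw [← hprod]
      refine bracket_prod_mem hn C b fun S _ hS => ih _ ?_ _
        (prod_mem_invariantsDegree ρ S e b fun i _ => hb i)
      obtain ⟨i, hi⟩ : ∃ i, i ∉ S := by
        by_contra! h
        exact hS (eq_univ_of_forall h)
      rw [← hsum]
      exact sum_lt_sum_of_subset (subset_univ S) (mem_univ i) hi (he i) fun _ _ _ => Nat.zero_le _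
    · rw [component_of_mem_ne hdeg.2 hkd, ← bracketLin_apply, map_zero]
      exact zero_mem _
  intro a ha
  have := key ha.1
  rwa [Submodule.mem_comap, LinearMap.comp_apply, component_of_mem ha.2, bracketLin_apply] at this

end

end

theorem corollary3p1 {K G V : Type*} [Field K] [Group G] [AddCommGroup V] [Module K V]
    [FiniteDimensional K V] (ρ : Representation K G V) (n : ℕ) (hn : 0 < n)
    (hK : ringChar K = 0 ∨ n < ringChar K)
    (q : ℕ) (hq : IsLeast {d : ℕ | 0 < d ∧ invariantsDegree ρ d ≠ ⊥} q)
    (𝓑 : ℕ → Set (SymmetricAlgebra K V))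
    (h𝓑 : ∀ d : ℕ, 0 < d → d < (n + 1) * q →
      LinearIndepOn K id (𝓑 d) ∧ Submodule.span K (𝓑 d) = invariantsDegree ρ d)
    (B : Set (SymmetricAlgebra K V))
    (hB : B = ⋃ d ∈ Set.Ioo 0 ((n + 1) * q), 𝓑 d) :
    (∃ S : Set (SymmetricAlgebra K (Fin n → V)), bracket n '' B ⊆ S ∧
      IsMinimalHomogeneousGenerating (polyInvariants (wreathRep ρ n)) S) ∧
    (Algebra.adjoin K (invariantsDegree ρ q : Set (SymmetricAlgebra K V)) = polyInvariants ρ →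
      IsMinimalHomogeneousGenerating (polyInvariants (wreathRep ρ n)) (bracket n '' B)) := by
  have hfac := factorial_ne_zero_of_ringChar hK
  have hq0 : ∀ d, 0 < d → d < q → invariantsDegree ρ d = ⊥ := fun d hd hdq => by
    by_contra h
    exact absurd (hq.2 ⟨hd, h⟩) (not_le.2 hdq)
  have hBmem : ∀ b ∈ B, ∃ d, 0 < d ∧ d < (n + 1) * q ∧ b ∈ invariantsDegree ρ d := by
    intro b hb
    rw [hB] at hb
    simp only [Set.mem_iUnion] at hb
    obtain ⟨d, ⟨hd, hdq⟩, hb⟩ := hb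
    exact ⟨d, hd, hdq, (h𝓑 d hd hdq).2 ▸ Submodule.subset_span hb⟩
  have hBli : LinearIndepOn K id B := by
    have hB' : B = ⋃ d, {b | b ∈ 𝓑 d ∧ d ∈ Set.Ioo 0 ((n + 1) * q)} := by
      rw [hB]
      ext b
      simp only [Set.mem_iUnion, Set.mem_ofPred_eq, exists_prop, and_comm]
    rw [hB']
    refine linearIndepOn_iUnion_of_homogeneous (fun d => ?_) fun d b hb => ?_
    · by_cases h : d ∈ Set.Ioo 0 ((n + 1) * q)
      · exact (h𝓑 d h.1 h.2).1.mono fun b hb => hb.1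
      · simp [h]
    · exact ((h𝓑 d hb.2.1 hb.2.2).2 ▸ Submodule.subset_span hb.1 : b ∈ invariantsDegree ρ d).2
  have hli := linearIndepOn_mkQ_bracket ρ hn hK hq0
    (fun b hb => (hBmem b hb).imp fun d h => ⟨h.1, h.2.1, h.2.2.2⟩) hBli
  have hhom : ∀ x ∈ bracket n '' B, ∃ d, 0 < d ∧ x ∈ symDegree K (Fin n → V) d := by
    rintro _ ⟨b, hb, rfl⟩
    obtain ⟨d, hd, -, hbd⟩ := hBmem b hb
    exact ⟨d, hd, sum_mem fun i _ => symMap_mem_symDegree _ hbd.2⟩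
  have hBR : bracket n '' B ⊆ polyInvariants (wreathRep ρ n) := by
    rintro _ ⟨b, hb, rfl⟩
    obtain ⟨d, -, -, hbd⟩ := hBmem b hb
    exact bracket_mem_polyInvariants ρ hbd.1
  refine ⟨exists_isMinimalHomogeneousGenerating_of_linearIndepOn
    (fun f hf d => component_mem_polyInvariants _ hf d) hBR hhom hli, fun hgen => ?_⟩
  refine isMinimalHomogeneousGenerating_of_linearIndepOn hhom ?_ hli
  refine adjoin_bracket_eq ρ hfac (fun b hb => (hBmem b hb).choose_spec.2.2.1) ?_
  refine bracket_mem_of_generated_in_degree ρ hfac hq.1.1 hgen _ fun d hd hdq a ha => ?_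
  rw [← (h𝓑 d hd hdq).2] at ha
  have hle : Submodule.span K (𝓑 d) ≤
      (Subalgebra.toSubmodule (Algebra.adjoin K (bracket n '' B))).comap (bracketLin n) := by
    refine Submodule.span_le.2 fun b hb => ?_
    rw [SetLike.mem_coe, Submodule.mem_comap, bracketLin_apply]
    refine Algebra.subset_adjoin ⟨b, ?_, rfl⟩
    rw [hB]
    exact Set.mem_biUnion ⟨hd, hdq⟩ hb
  have := hle ha
  rwa [Submodule.mem_comap, bracketLin_apply] at this
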